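/- For $n\ge 0$ let $GM_n$ be the set of Grand Motzkin paths of length $n$, i.e. lattice paths with $n$ steps, each equal to $U=(1,1)$, $D=(1,-1)$ or $H=(1,0)$, starting at the origin and ending on the $x$-axis, partially ordered by $\gamma_1\le\gamma_2$ if and only if $\gamma_1$ lies weakly below $\gamma_2$ (the $n$-th Grand Motzkin lattice). For a finite poset $P$ let $\ell(P)$ be the number of edges of its Hasse diagram (the number of pairs $(x,y)$ such that $y$ covers $x$), and let $i(P)=\ell(P)/|P|$ be its Hasse index. Let $\binom{n;\,3}{k}$ denote the coefficient of $x^k$ in $(1+x+x^2)^n$, and write $a_n\sim b_n$ if $a_n/b_n\to1$ as $n\to\infty$. The edge generating series of the Grand Motzkin lattices is, as a formal power series (the square root being the one with constant term $1$), $$\sum_{n\ge0}\ell(GM_n)\,x^n=\frac{2x^2}{(1-3x)\sqrt{1-2x-3x^2}}.$$ Moreover, for every $n\ge0$, $$\ell(GM_{n+2})=2\sum_{k=0}^n\binom{k;\,3}{k}3^{n-k},$$ $$\ell(GM_{n+2})=\frac{2}{4^n}\sum_{k=0}^n\binom{2k}{k}\binom{2n-2k}{n-k}(2k+1)\,3^k(-1)^{n-k},$$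 $$\ell(GM_{n+2})=2\sum_{k=0}^n\binom{n+1}{k+1}\binom{2k}{k}(-1)^k3^{n-k},$$ and, as $n\to\infty$, $$\ell(GM_n)\sim 2\cdot3^{n-2}\sqrt{\frac{3n}{\pi}}\qquad\text{and}\qquad i(GM_n)\sim\frac49\,n.$$ In particular, the Hasse index of the Grand Motzkin lattices is asymptotically quasi Boolean, i.e. there is a constant $c$ with $0\le c\le 1/10$ such that $i(GM_n)\sim(\tfrac12+c)\,n$ or $i(GM_n)\sim(\tfrac12-c)\,n$. -/

import Mathlib

open Filter Asymptotics Topology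

/-- The number of edges of the Hasse diagram of a poset `P`, i.e. the number of pairs
`(x, y)` such that `y` covers `x`. -/
noncomputable def hasseEdges (P : Type*) [PartialOrder P] : ℕ :=
  Nat.card {e : P × P // e.1 ⋖ e.2}

/-- The Hasse index of a poset: number of edges of the Hasse diagram over number of elements. -/
noncomputable def hasseIndex (P : Type*) [PartialOrder P] : ℝ :=
  (hasseEdges P : ℝ) / (Nat.card P : ℝ)

/-- The edge generating series of a sequence of posets. -/
noncomputable def edgeSeries (P : ℕ → Type*) [∀ n, PartialOrder (P n)] : PowerSeries ℚ :=
  PowerSeries.mk fun n => (hasseEdges (P n) : ℚ)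

/-- The Hasse index of a sequence of posets is asymptotically quasi Boolean if
`i(P_n) ∼ (1/2 ± c) n` for some constant `0 ≤ c ≤ 1/10`. -/
def AsymptoticallyQuasiBoolean (P : ℕ → Type*) [∀ n, PartialOrder (P n)] : Prop :=
  ∃ c : ℝ, 0 ≤ c ∧ c ≤ 1 / 10 ∧
    ((fun n : ℕ => hasseIndex (P n)) ~[atTop] (fun n : ℕ => (1 / 2 + c) * (n : ℝ)) ∨
      (fun n : ℕ => hasseIndex (P n)) ~[atTop] (fun n : ℕ => (1 / 2 - c) * (n : ℝ)))

/-- `S` is the formal square root, with constant term `1`, of the power series `f`. -/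
def IsFormalSqrt (S f : PowerSeries ℚ) : Prop :=
  PowerSeries.constantCoeff S = 1 ∧ S ^ 2 = f

/-- The trinomial coefficient: the coefficient of `x ^ k` in `(1 + x + x ^ 2) ^ n`. -/
noncomputable def trinomial (n k : ℕ) : ℕ :=
  ((1 + Polynomial.X + Polynomial.X ^ 2 : Polynomial ℕ) ^ n).coeff k

/-- The steps `U = (1, 1)`, `D = (1, -1)` and `H = (1, 0)`. -/
inductive MotzkinStep where
  | U
  | D
  | H
deriving DecidableEq

instance : Fintype MotzkinStep :=
  ⟨{MotzkinStep.U, MotzkinStep.D, MotzkinStep.H}, fun s => by cases s <;> simp⟩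

/-- The vertical displacement of a step (the horizontal one is always `1`). -/
def MotzkinStep.rise : MotzkinStep → ℤ
  | .U => 1
  | .D => -1
  | .H => 0

/-- Grand Motzkin paths of length `n`: sequences of `n` steps `U`, `D`, `H` leading from the
origin to a point of the `x`-axis. -/
@[ext]
structure GrandMotzkin (n : ℕ) where
  step : Fin n → MotzkinStep
  ends_on_axis : ∑ i, (step i).rise = 0

namespace GrandMotzkin

variable {n : ℕ}

/-- The ordinate of the point of abscissa `k` of a path, for `k ≤ n`. -/
def height (γ : GrandMotzkin n) (k : ℕ) : ℤ :=
  ∑ i : Fin n with i.val < k, (γ.step i).rise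

theorem height_succ (γ : GrandMotzkin n) (i : Fin n) :
    γ.height (i.val + 1) = γ.height i.val + (γ.step i).rise := by
  unfold height
  have h : (Finset.univ.filter fun j : Fin n => j.val < i.val + 1)
      = insert i (Finset.univ.filter fun j : Fin n => j.val < i.val) := by
    ext j
    simp only [Finset.mem_filter, Finset.mem_univ, true_and, Finset.mem_insert, Fin.ext_iff]
    omega
  rw [h, Finset.sum_insert (by simp), add_comm]

theorem ext_height {γ₁ γ₂ : GrandMotzkin n} (h : ∀ k ≤ n, γ₁.height k = γ₂.height k) :
    γ₁ = γ₂ := by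
  ext i
  have h1 := h i.val i.isLt.le
  have h2 := h (i.val + 1) i.isLt
  rw [height_succ, height_succ, h1, add_right_inj] at h2
  revert h2
  cases γ₁.step i <;> cases γ₂.step i <;> simp [MotzkinStep.rise]

/-- `γ₁ ≤ γ₂` when `γ₁` lies weakly below `γ₂`. -/
instance : PartialOrder (GrandMotzkin n) where
  le γ₁ γ₂ := ∀ k ≤ n, γ₁.height k ≤ γ₂.height k
  le_refl _ _ _ := le_rfl
  le_trans _ _ _ h₁ h₂ k hk := (h₁ k hk).trans (h₂ k hk)
  le_antisymm _ _ h₁ h₂ := ext_height fun k hk => le_antisymm (h₁ k hk) (h₂ k hk)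

instance : Finite (GrandMotzkin n) :=
  Finite.of_injective GrandMotzkin.step fun _ _ h => GrandMotzkin.ext h

end GrandMotzkin

/-!
A cover of a path `γ` in the Grand Motzkin lattice is obtained by lifting one weak local minimum of
`γ` by one unit. Hence the edges of the Hasse diagram are the pairs of a path and one of its
`n + 1` interior positions at which the step before is `D` or `H` and the step after is `U` or `H`.
Writing the steps as monomials, the paths with a prescribed such position are counted by the
coefficient of `x ^ (n + 2)` in `(1 + x) (x + x ^ 2) (1 + x + x ^ 2) ^ n`, so that
`ℓ (n + 2) = (n + 1) (T n + T (n + 1))` with `T n` the central trinomial coefficients.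

The three-term recurrence for `T` turns this into `ℓ (n + 3) = 3 ℓ (n + 2) + 2 T (n + 1)`, and is
equivalent to a differential equation with solution
`∑ T n x ^ n = ((1 - 3 x) (1 + x)) ^ (-1 / 2)`. This gives the generating series and the summation
formulas. In the convolution of the two binomial series the singularity at `x = 1 / 3` dominates,
so `T n` is asymptotic to the `n`-th coefficient of `(1 - 3 x) ^ (-1 / 2)` times the value `√3 / 2`
of `(1 + x) ^ (-1 / 2)` at `1 / 3`.
-/

section Counting

open Polynomial

theorem coeff_prod_sum_X_pow {ι α : Type*} [Fintype ι] [DecidableEq ι] (w : α → ℕ)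
    (t : ι → Finset α) (k : ℕ) :
    (∏ i, ∑ a ∈ t i, (X : ℕ[X]) ^ w a).coeff k
      = (Fintype.piFinset t |>.filter fun s => ∑ i, w (s i) = k).card := by
  simp only [Finset.prod_univ_sum, Finset.prod_pow_eq_pow_sum, finsetSum_coeff, coeff_X_pow,
    Finset.card_filter, eq_comm (a := k)]

end Counting

namespace MotzkinStep

/-- The rise of a step, shifted by one so as to be the degree of a monomial. -/
def weight : MotzkinStep → ℕ
  | .U => 2
  | .D => 0
  | .H => 1

/-- The step of rise `r`; any `r` other than `1` and `-1` gives a horizontal step. -/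
def ofRise (r : ℤ) : MotzkinStep :=
  if r = 1 then .U else if r = -1 then .D else .H

theorem rise_eq_weight_sub_one (s : MotzkinStep) : s.rise = s.weight - 1 := by
  cases s <;> rfl

theorem abs_rise_le (s : MotzkinStep) : |s.rise| ≤ 1 := by
  cases s <;> simp [rise]

theorem rise_nonpos_iff {s : MotzkinStep} : s.rise ≤ 0 ↔ s ∈ ({.D, .H} : Finset _) := by
  cases s <;> simp [rise]

theorem rise_nonneg_iff {s : MotzkinStep} : 0 ≤ s.rise ↔ s ∈ ({.U, .H} : Finset _) := by
  cases s <;> simp [rise]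

theorem rise_ofRise {r : ℤ} (hr : |r| ≤ 1) : (ofRise r).rise = r := by
  obtain ⟨h₁, h₂⟩ := abs_le.1 hr
  unfold ofRise
  split_ifs <;> simp only [rise] <;> omega

theorem sum_rise_eq_zero_iff {n : ℕ} (s : Fin n → MotzkinStep) :
    ∑ i, (s i).rise = 0 ↔ ∑ i, (s i).weight = n := by
  simp only [rise_eq_weight_sub_one, Finset.sum_sub_distrib, Finset.sum_const, Finset.card_univ,
    Fintype.card_fin, nsmul_eq_mul, mul_one, sub_eq_zero]
  norm_cast

open Polynomial in
theorem sum_X_pow_weight : ∑ s : MotzkinStep, (X : ℕ[X]) ^ s.weight = 1 + X + X ^ 2 := by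
  have huniv : (Finset.univ : Finset MotzkinStep) = {.U, .D, .H} := rfl
  rw [huniv, Finset.sum_insert (by simp), Finset.sum_pair (by simp)]
  simp only [weight]
  ring

end MotzkinStep

namespace GrandMotzkin

variable {n : ℕ}

section Heights

theorem height_zero (γ : GrandMotzkin n) : γ.height 0 = 0 := by
  simp [height]

theorem height_of_le (γ : GrandMotzkin n) {k : ℕ} (hk : n ≤ k) : γ.height k = 0 := by
  rw [← γ.ends_on_axis, height, Finset.filter_true_of_mem fun i _ => i.isLt.trans_le hk]

theorem abs_height_succ_sub_le (γ : GrandMotzkin n) (k : ℕ) :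
    |γ.height (k + 1) - γ.height k| ≤ 1 := by
  rcases lt_or_ge k n with hk | hk
  · rw [γ.height_succ ⟨k, hk⟩, add_sub_cancel_left]
    exact MotzkinStep.abs_rise_le _
  · simp [γ.height_of_le hk, γ.height_of_le (hk.trans k.le_succ)]

/-- Paths ordered by their height functions, which vanish from the abscissa `n` on. -/
def heightEmbedding (n : ℕ) : GrandMotzkin n ↪o (ℕ → ℤ) where
  toFun := height
  inj' _ _ h := ext_height fun k _ => congrFun h k
  map_rel_iff' {γ₁ γ₂} := by
    refine ⟨fun h k _ => h k, fun h k => ?_⟩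
    rcases le_total k n with hk | hk
    · exact h k hk
    · exact (γ₁.height_of_le hk).trans_le (γ₂.height_of_le hk).ge

theorem height_le_height_iff {γ₁ γ₂ : GrandMotzkin n} : γ₁.height ≤ γ₂.height ↔ γ₁ ≤ γ₂ :=
  (heightEmbedding n).le_iff_le

theorem height_lt_height_iff {γ₁ γ₂ : GrandMotzkin n} : γ₁.height < γ₂.height ↔ γ₁ < γ₂ :=
  (heightEmbedding n).lt_iff_lt

/-- The path with a prescribed height function. -/
def ofHeight (h : ℕ → ℤ) (h_zero : h 0 = 0) (h_of_le : ∀ k, n ≤ k → h k = 0)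
    (h_step : ∀ k, |h (k + 1) - h k| ≤ 1) : GrandMotzkin n where
  step i := .ofRise (h (i + 1) - h i)
  ends_on_axis := by
    simp only [MotzkinStep.rise_ofRise (h_step _)]
    rw [Fin.sum_univ_eq_sum_range fun i => h (i + 1) - h i, Finset.sum_range_sub, h_zero,
      h_of_le n le_rfl, sub_zero]

theorem height_ofHeight (h : ℕ → ℤ) (h_zero : h 0 = 0) (h_of_le : ∀ k, n ≤ k → h k = 0)
    (h_step : ∀ k, |h (k + 1) - h k| ≤ 1) : (ofHeight h h_zero h_of_le h_step).height = h := by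
  funext k
  induction k with
  | zero => rw [height_zero, h_zero]
  | succ k ih =>
    rcases lt_or_ge k n with hk | hk
    · rw [height_succ _ ⟨k, hk⟩, ih]
      simp only [ofHeight, MotzkinStep.rise_ofRise (h_step _)]
      ring
    · rw [height_of_le _ (hk.trans k.le_succ), h_of_le _ (hk.trans k.le_succ)]

end Heights

section Valleys

/-- The point of abscissa `i + 1` is a weak local minimum of the path. These are the points that
can be moved one unit upwards. -/
def IsValley (γ : GrandMotzkin (n + 2)) (i : Fin (n + 1)) : Prop :=
  γ.height (i + 1) ≤ γ.height i ∧ γ.height (i + 1) ≤ γ.height (i + 1 + 1)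

/-- The path obtained by moving the valley of abscissa `i + 1` one unit upwards. -/
def raise (γ : GrandMotzkin (n + 2)) (i : Fin (n + 1)) (hi : γ.IsValley i) :
    GrandMotzkin (n + 2) :=
  ofHeight (Function.update γ.height (i + 1) (γ.height (i + 1) + 1))
    (by simp [height_zero])
    (fun k hk => by
      rw [Function.update_of_ne (by omega), γ.height_of_le hk])
    (fun k => by
      obtain ⟨hleft, hright⟩ := hi
      have hk := abs_le.1 (γ.abs_height_succ_sub_le k)
      rw [abs_le]
      simp only [Function.update_apply]
      split_ifs with h₁ h₂ h₂
      · omega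
      · obtain rfl : k = i := by omega
        omega
      · subst h₂
        omega
      · exact hk)

theorem height_raise (γ : GrandMotzkin (n + 2)) (i : Fin (n + 1)) (hi : γ.IsValley i) :
    (γ.raise i hi).height = Function.update γ.height (i + 1) (γ.height (i + 1) + 1) :=
  height_ofHeight ..

theorem raise_covBy (γ : GrandMotzkin (n + 2)) (i : Fin (n + 1)) (hi : γ.IsValley i) :
    γ ⋖ γ.raise i hi :=
  .of_image (heightEmbedding _) <|
    Pi.covBy_iff_exists_right_eq.2 ⟨i + 1, _, Order.covBy_add_one _, γ.height_raise i hi⟩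

theorem raise_le_iff {γ₁ γ₂ : GrandMotzkin (n + 2)} {i : Fin (n + 1)} {hi : γ₁.IsValley i}
    (hle : γ₁ ≤ γ₂) : γ₁.raise i hi ≤ γ₂ ↔ γ₁.height (i + 1) < γ₂.height (i + 1) := by
  rw [← height_le_height_iff, height_raise, update_le_iff, Int.add_one_le_iff]
  exact and_iff_left fun k _ => height_le_height_iff.2 hle k

theorem exists_height_lt_of_lt {γ₁ γ₂ : GrandMotzkin n} (h : γ₁ < γ₂) :
    ∃ k, γ₁.height k < γ₂.height k ∧
      ∀ j, γ₁.height j < γ₂.height j → γ₁.height k ≤ γ₁.height j := by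
  have hfinite : {k | γ₁.height k < γ₂.height k}.Finite :=
    (Set.finite_lt_nat n).subset fun k hk => by
      by_contra hkn
      simp only [Set.mem_ofPred_eq, not_lt] at hk hkn
      simp [height_of_le _ hkn] at hk
  exact Set.exists_min_image _ γ₁.height hfinite (Pi.lt_def.1 (height_lt_height_iff.2 h)).2

/-- Where `γ₁` lies strictly below `γ₂` and is lowest possible, a strictly lower neighbour would
be at least two units below `γ₂`'s point, hence again strictly below `γ₂`. -/
theorem isValley_of_height_lt {γ₁ γ₂ : GrandMotzkin (n + 2)} {i : Fin (n + 1)}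
    (hlt : γ₁.height (i + 1) < γ₂.height (i + 1))
    (hmin : ∀ j, γ₁.height j < γ₂.height j → γ₁.height (i + 1) ≤ γ₁.height j) :
    γ₁.IsValley i := by
  have hleft := abs_le.1 (γ₂.abs_height_succ_sub_le i)
  have hright := abs_le.1 (γ₂.abs_height_succ_sub_le (i + 1))
  have hmin_left := hmin i
  have hmin_right := hmin (i + 1 + 1)
  constructor <;> omega

theorem exists_raise_le {γ₁ γ₂ : GrandMotzkin (n + 2)} (h : γ₁ < γ₂) :
    ∃ i, ∃ hi : γ₁.IsValley i, γ₁.raise i hi ≤ γ₂ := by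
  obtain ⟨k, hlt, hmin⟩ := exists_height_lt_of_lt h
  have hpos : k ≠ 0 := by
    rintro rfl
    simp [height_zero] at hlt
  have hkn : k < n + 2 := by
    by_contra! hk
    simp [height_of_le _ hk] at hlt
  obtain ⟨i, rfl⟩ := Nat.exists_eq_succ_of_ne_zero hpos
  have hi : γ₁.IsValley ⟨i, by omega⟩ := isValley_of_height_lt hlt hmin
  exact ⟨_, hi, (raise_le_iff h.le).2 hlt⟩

theorem covBy_iff_exists_raise {γ₁ γ₂ : GrandMotzkin (n + 2)} :
    γ₁ ⋖ γ₂ ↔ ∃ i, ∃ hi : γ₁.IsValley i, γ₁.raise i hi = γ₂ := by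
  constructor
  · intro h
    obtain ⟨i, hi, hle⟩ := exists_raise_le h.lt
    exact ⟨i, hi, hle.eq_of_not_lt (h.2 (γ₁.raise_covBy i hi).lt)⟩
  · rintro ⟨i, hi, rfl⟩
    exact γ₁.raise_covBy i hi

theorem eq_of_raise_eq_raise {γ : GrandMotzkin (n + 2)} {i j : Fin (n + 1)} (hi : γ.IsValley i)
    (hj : γ.IsValley j) (h : γ.raise i hi = γ.raise j hj) : i = j := by
  by_contra hij
  have hheight := congrFun (congrArg height h) (i + 1)
  rw [height_raise, height_raise, Function.update_self, Function.update_of_ne (by omega)] at hheight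
  omega

theorem hasseEdges_eq_sum_card_isValley (n : ℕ) :
    hasseEdges (GrandMotzkin (n + 2))
      = ∑ i : Fin (n + 1), Nat.card {γ : GrandMotzkin (n + 2) // γ.IsValley i} := by
  let toEdge : (Σ i : Fin (n + 1), {γ : GrandMotzkin (n + 2) // γ.IsValley i}) →
      {e : GrandMotzkin (n + 2) × GrandMotzkin (n + 2) // e.1 ⋖ e.2} :=
    fun v => ⟨(v.2.1, v.2.1.raise v.1 v.2.2), v.2.1.raise_covBy v.1 v.2.2⟩
  have hbij : Function.Bijective toEdge := by
    constructor
    · rintro ⟨i, γ, hi⟩ ⟨j, γ', hj⟩ h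
      obtain ⟨rfl, h⟩ := Prod.ext_iff.1 (Subtype.ext_iff.1 h)
      obtain rfl := eq_of_raise_eq_raise hi hj h
      rfl
    · rintro ⟨⟨γ₁, γ₂⟩, h⟩
      obtain ⟨i, hi, hraise⟩ := covBy_iff_exists_raise.1 h
      exact ⟨⟨i, γ₁, hi⟩, Subtype.ext (Prod.ext rfl hraise)⟩
  rw [hasseEdges, ← Nat.card_congr (Equiv.ofBijective toEdge hbij), Nat.card_sigma]

theorem hasseEdges_of_le_one (hn : n ≤ 1) : hasseEdges (GrandMotzkin n) = 0 := by
  have : Subsingleton (GrandMotzkin n) := ⟨fun γ₁ γ₂ => ext_height fun k _ => by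
    rcases k.eq_zero_or_pos with rfl | hk
    · rw [height_zero, height_zero]
    · rw [height_of_le _ (hn.trans hk), height_of_le _ (hn.trans hk)]⟩
  have : IsEmpty {e : GrandMotzkin n × GrandMotzkin n // e.1 ⋖ e.2} :=
    ⟨fun e => e.2.ne (Subsingleton.elim _ _)⟩
  exact Nat.card_of_isEmpty

end Valleys

section Counting

open Polynomial hiding trinomial

theorem card_step_mem (t : Fin n → Finset MotzkinStep) :
    Nat.card {γ : GrandMotzkin n // ∀ i, γ.step i ∈ t i}
      = (∏ i, ∑ s ∈ t i, (X : ℕ[X]) ^ s.weight).coeff n := by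
  rw [coeff_prod_sum_X_pow,
    ← Nat.subtype_card (p := fun s => (∀ i, s i ∈ t i) ∧ ∑ i, (s i).weight = n) _ (by simp)]
  exact Nat.card_congr
    { toFun γ := ⟨γ.1.step, γ.2, (MotzkinStep.sum_rise_eq_zero_iff _).1 γ.1.ends_on_axis⟩
      invFun s := ⟨⟨s.1, (MotzkinStep.sum_rise_eq_zero_iff _).2 s.2.2⟩, s.2.1⟩
      left_inv _ := rfl
      right_inv _ := rfl }

theorem card_eq_trinomial (n : ℕ) : Nat.card (GrandMotzkin n) = trinomial n n := by
  have hcard := card_step_mem (n := n) fun _ => Finset.univ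
  rw [MotzkinStep.sum_X_pow_weight, Finset.prod_const, Finset.card_univ, Fintype.card_fin] at hcard
  rw [trinomial, ← hcard]
  exact Nat.card_congr (Equiv.subtypeUnivEquiv fun _ _ => Finset.mem_univ _).symm

/-- The steps allowed at each position of a path with a valley at the abscissa `i + 1`. -/
def valleySteps (i : Fin (n + 1)) : Fin (n + 2) → Finset MotzkinStep :=
  Function.update (Function.update (fun _ => Finset.univ) i.castSucc {.D, .H}) i.succ {.U, .H}

theorem isValley_iff_forall_step_mem {γ : GrandMotzkin (n + 2)} {i : Fin (n + 1)} :
    γ.IsValley i ↔ ∀ j, γ.step j ∈ valleySteps i j := by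
  have hleft := γ.height_succ i.castSucc
  have hright := γ.height_succ i.succ
  simp only [Fin.val_castSucc, Fin.val_succ] at hleft hright
  have hne : i.castSucc ≠ i.succ := i.castSucc_lt_succ.ne
  rw [IsValley, hright, hleft, add_le_iff_nonpos_right, le_add_iff_nonneg_right,
    MotzkinStep.rise_nonpos_iff, MotzkinStep.rise_nonneg_iff]
  constructor
  · rintro ⟨hD, hU⟩ j
    simp only [valleySteps, Function.update_apply]
    split_ifs with h₁ h₂
    · exact h₁ ▸ hU
    · exact h₂ ▸ hD
    · exact Finset.mem_univ _
  · intro h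
    have hD := h i.castSucc
    have hU := h i.succ
    rw [valleySteps, Function.update_of_ne hne, Function.update_self] at hD
    rw [valleySteps, Function.update_self] at hU
    exact ⟨hD, hU⟩

theorem prod_sum_valleySteps (i : Fin (n + 1)) :
    ∏ j, ∑ s ∈ valleySteps i j, (X : ℕ[X]) ^ s.weight
      = X * (X * (1 + X + X ^ 2) ^ n + (1 + X + X ^ 2) ^ (n + 1)) := by
  have hupdate : ∀ j, ∑ s ∈ valleySteps i j, (X : ℕ[X]) ^ s.weight
      = Function.update (Function.update (fun _ => 1 + X + X ^ 2) i.castSucc (1 + X))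
          i.succ (X ^ 2 + X) j := fun j => by
    simp only [valleySteps, Function.update_apply]
    split_ifs
    · simp [MotzkinStep.weight]
    · simp [MotzkinStep.weight]
    · exact MotzkinStep.sum_X_pow_weight
  have hcard : ((Finset.univ \ {i.succ}) \ {i.castSucc}).card = n := by
    rw [sdiff_sdiff, Finset.sup_eq_union, ← Finset.compl_eq_univ_sdiff, Finset.card_compl,
      ← Finset.insert_eq, Finset.card_pair i.castSucc_lt_succ.ne', Fintype.card_fin]
    rfl
  rw [Finset.prod_congr rfl fun j _ => hupdate j, Finset.prod_update_of_mem (Finset.mem_univ _),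
    Finset.prod_update_of_mem (by simp [i.castSucc_lt_succ.ne]), Finset.prod_const, hcard]
  ring

theorem card_isValley (i : Fin (n + 1)) :
    Nat.card {γ : GrandMotzkin (n + 2) // γ.IsValley i}
      = trinomial n n + trinomial (n + 1) (n + 1) := by
  rw [Nat.card_congr (Equiv.subtypeEquivRight fun _ => isValley_iff_forall_step_mem),
    card_step_mem, prod_sum_valleySteps, coeff_X_mul, coeff_add, coeff_X_mul, trinomial, trinomial]

theorem hasseEdges_add_two (n : ℕ) :
    hasseEdges (GrandMotzkin (n + 2))
      = (n + 1) * (trinomial n n + trinomial (n + 1) (n + 1)) := by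
  simp [hasseEdges_eq_sum_card_isValley, card_isValley]

end Counting

end GrandMotzkin

section Trinomials

open Polynomial hiding trinomial

theorem trinomial_zero_zero : trinomial 0 0 = 1 := by
  simp [trinomial]

theorem trinomial_one_one : trinomial 1 1 = 1 := by
  simp [trinomial, coeff_X, coeff_one]

theorem trinomial_succ_add_two (n k : ℕ) :
    trinomial (n + 1) (k + 2) = trinomial n (k + 2) + trinomial n (k + 1) + trinomial n k := by
  have hpow : (1 + X + X ^ 2 : ℕ[X]) ^ (n + 1)
      = (1 + X + X ^ 2) ^ n + X * (1 + X + X ^ 2) ^ n + X * (X * (1 + X + X ^ 2) ^ n) := by ring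
  simp only [trinomial, hpow, coeff_add, coeff_X_mul]

/-- Compare coefficients in the derivative of `(1 + X + X ^ 2) ^ (n + 1)`. -/
theorem add_two_mul_trinomial_succ (n k : ℕ) :
    (k + 2) * trinomial (n + 1) (k + 2)
      = (n + 1) * (trinomial n (k + 1) + 2 * trinomial n k) := by
  have hderiv : derivative ((1 + X + X ^ 2 : ℕ[X]) ^ (n + 1))
      = C (n + 1) * ((1 + X + X ^ 2) ^ n + 2 * (X * (1 + X + X ^ 2) ^ n)) := by
    simp only [derivative_pow_succ, derivative_add, derivative_one, derivative_X]
    push_cast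
    simp only [map_add, map_one, map_ofNat]
    ring
  have hcoeff := congrArg (coeff · (k + 1)) hderiv
  simp only [coeff_derivative, coeff_C_mul, coeff_add, coeff_ofNat_mul, coeff_X_mul] at hcoeff
  simp only [trinomial]
  push_cast at hcoeff ⊢
  linarith

theorem trinomial_add_two_self (n : ℕ) :
    trinomial (n + 2) (n + 2) = trinomial (n + 1) (n + 1) + 2 * trinomial (n + 1) n :=
  Nat.eq_of_mul_eq_mul_left (Nat.succ_pos (n + 1)) (add_two_mul_trinomial_succ (n + 1) n)

theorem add_three_mul_trinomial_add_two_succ (n : ℕ) :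
    (n + 3) * trinomial (n + 2) (n + 1)
      = (n + 2) * (2 * trinomial (n + 1) (n + 1) + trinomial (n + 1) n) := by
  rcases n with - | n
  · simp [trinomial, pow_two, mul_add, add_mul, mul_assoc, coeff_X, coeff_one]
  · have hpascal := trinomial_succ_add_two (n + 2) n
    have hderiv := add_two_mul_trinomial_succ (n + 2) n
    simp only [add_assoc, Nat.reduceAdd] at *
    zify at *
    linear_combination 2 * (n + 3) * hpascal - hderiv

theorem add_two_mul_trinomial_add_two_self (n : ℕ) :
    (n + 2) * trinomial (n + 2) (n + 2)
      = (2 * n + 3) * trinomial (n + 1) (n + 1) + 3 * (n + 1) * trinomial n n := by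
  rcases n with - | n
  · have h := trinomial_add_two_self 0
    have h₀ : trinomial 1 0 = 1 := by simp [trinomial]
    simp only [zero_add, trinomial_one_one, trinomial_zero_zero, h₀] at h ⊢
    omega
  · have h₁ := trinomial_add_two_self (n + 1)
    have h₂ := trinomial_add_two_self n
    have h₃ := add_three_mul_trinomial_add_two_succ n
    simp only [add_assoc, Nat.reduceAdd] at *
    zify at *
    linear_combination (n + 3) * h₁ + 2 * h₃ - (n + 2) * h₂

/-- Expand `1 + X + X ^ 2 = (1 - X) ^ 2 + 3 X` by the binomial theorem. -/
theorem trinomial_eq_sum_centralBinom (n : ℕ) :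
    (trinomial n n : ℤ)
      = ∑ k ∈ Finset.range (n + 1), (n.choose k : ℤ) * k.centralBinom * (-1) ^ k * 3 ^ (n - k) := by
  have hexpand : ((1 + X + X ^ 2 : ℕ[X]) ^ n).map (Nat.castRingHom ℤ)
      = ∑ k ∈ Finset.range (n + 1), C ((n.choose k : ℤ) * 3 ^ (n - k))
          * (X ^ (n - k) * ((1 + X) ^ (2 * k)).comp (C (-1) * X)) := by
    simp only [Polynomial.map_pow, Polynomial.map_add, Polynomial.map_one, map_X]
    rw [show (1 + X + X ^ 2 : ℤ[X]) = (1 - X) ^ 2 + C 3 * X by rw [C_ofNat]; ring, add_pow]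
    refine Finset.sum_congr rfl fun k _ => ?_
    simp only [pow_comp, add_comp, one_comp, X_comp, C_neg, C_1, neg_one_mul, ← sub_eq_add_neg,
      mul_pow, ← pow_mul, C_mul, C_pow, map_natCast]
    ring
  rw [trinomial, ← eq_natCast (Nat.castRingHom ℤ), ← coeff_map, hexpand, finsetSum_coeff]
  refine Finset.sum_congr rfl fun k hk => ?_
  rw [coeff_C_mul, coeff_X_pow_mul', if_pos (Nat.sub_le n k),
    Nat.sub_sub_self (Finset.mem_range_succ_iff.1 hk), comp_C_mul_X_coeff, coeff_one_add_X_pow,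
    Nat.centralBinom]
  ring

end Trinomials

section SummationFormulas

open GrandMotzkin

theorem eq_sum_range_mul_pow_of_succ_eq {R : Type*} [CommSemiring R] {r : R} {a b : ℕ → R}
    (h_zero : a 0 = b 0) (h_succ : ∀ n, a (n + 1) = r * a n + b (n + 1)) (n : ℕ) :
    a n = ∑ k ∈ Finset.range (n + 1), b k * r ^ (n - k) := by
  induction n with
  | zero => simp [h_zero]
  | succ n ih =>
    rw [h_succ, ih, Finset.sum_range_succ _ (n + 1), Nat.sub_self, pow_zero, mul_one,
      Finset.mul_sum]
    congr 1
    refine Finset.sum_congr rfl fun k hk => ?_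
    rw [Nat.succ_sub (Finset.mem_range_succ_iff.1 hk), pow_succ]
    ring

theorem hasseEdges_two : hasseEdges (GrandMotzkin 2) = 2 := by
  rw [hasseEdges_add_two, trinomial_zero_zero, trinomial_one_one]

theorem hasseEdges_add_three (n : ℕ) :
    hasseEdges (GrandMotzkin (n + 3))
      = 3 * hasseEdges (GrandMotzkin (n + 2)) + 2 * trinomial (n + 1) (n + 1) := by
  have hrec := add_two_mul_trinomial_add_two_self n
  rw [hasseEdges_add_two n, hasseEdges_add_two (n + 1)]
  linarith

theorem hasseEdges_eq_sum_trinomial (n : ℕ) :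
    hasseEdges (GrandMotzkin (n + 2))
      = 2 * ∑ k ∈ Finset.range (n + 1), trinomial k k * 3 ^ (n - k) := by
  rw [eq_sum_range_mul_pow_of_succ_eq (a := fun n => hasseEdges (GrandMotzkin (n + 2)))
    (b := fun n => 2 * trinomial n n) (by simp [hasseEdges_two, trinomial_zero_zero])
    hasseEdges_add_three, Finset.mul_sum]
  simp only [mul_assoc]

theorem hasseEdges_eq_sum_choose (n : ℕ) :
    (hasseEdges (GrandMotzkin (n + 2)) : ℤ)
      = 2 * ∑ k ∈ Finset.range (n + 1),
          ((n + 1).choose (k + 1) : ℤ) * k.centralBinom * (-1) ^ k * 3 ^ (n - k) := by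
  have hterm : ∀ m ∈ Finset.range (n + 1), (trinomial m m : ℤ) * 3 ^ (n - m)
      = ∑ k ∈ Finset.range (m + 1), (m.choose k : ℤ) * (k.centralBinom * (-1) ^ k * 3 ^ (n - k)) :=
    fun m hm => by
      rw [trinomial_eq_sum_centralBinom, Finset.sum_mul]
      refine Finset.sum_congr rfl fun k hk => ?_
      rw [Finset.mem_range_succ_iff] at hm hk
      rw [← Nat.sub_add_sub_cancel hm hk, pow_add]
      ring
  have hcomm : ∀ m k, m ∈ Finset.range (n + 1) ∧ k ∈ Finset.range (m + 1) ↔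
      m ∈ Finset.Icc k n ∧ k ∈ Finset.range (n + 1) := fun m k => by
    simp only [Finset.mem_range, Finset.mem_Icc]
    omega
  rw [hasseEdges_eq_sum_trinomial]
  push_cast
  rw [Finset.sum_congr rfl hterm, Finset.sum_comm' hcomm]
  simp only [← Finset.sum_mul, ← Nat.cast_sum, Nat.sum_Icc_choose, mul_assoc]

end SummationFormulas

section BinomialSeries

open PowerSeries

variable {K : Type*} [Field K] [CharZero K]

theorem succ_mul_choose_succ (r : K) (n : ℕ) :
    (n + 1) * Ring.choose r (n + 1) = (r - n) * Ring.choose r n := by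
  have h := Ring.choose_smul_choose r n.le_succ
  rw [Nat.succ_eq_add_one, Nat.choose_succ_self_right, Nat.add_sub_cancel_left,
    Ring.choose_one_right, nsmul_eq_mul, Nat.cast_add_one] at h
  rw [h, mul_comm]

theorem choose_neg_half (n : ℕ) :
    Ring.choose (-1 / 2 : K) n = (-1 / 4) ^ n * n.centralBinom := by
  induction n with
  | zero => simp
  | succ n ih =>
    have hchoose := succ_mul_choose_succ (-1 / 2 : K) n
    have hcentral : ((n : K) + 1) * (n + 1).centralBinom = 2 * (2 * n + 1) * n.centralBinom := by
      exact_mod_cast n.succ_mul_centralBinom_succ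
    have hne : (n : K) + 1 ≠ 0 := Nat.cast_add_one_ne_zero n
    refine mul_left_cancel₀ hne ?_
    rw [hchoose, ih]
    linear_combination -(-1 / 4) ^ (n + 1) * hcentral

theorem choose_neg_three_halves (n : ℕ) :
    Ring.choose (-3 / 2 : K) n = (-1 / 4) ^ n * ((2 * n + 1) * n.centralBinom) := by
  induction n with
  | zero => simp
  | succ n ih =>
    have hchoose := succ_mul_choose_succ (-3 / 2 : K) n
    have hcentral : ((n : K) + 1) * (n + 1).centralBinom = 2 * (2 * n + 1) * n.centralBinom := by
      exact_mod_cast n.succ_mul_centralBinom_succ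
    have hne : (n : K) + 1 ≠ 0 := Nat.cast_add_one_ne_zero n
    refine mul_left_cancel₀ hne ?_
    rw [hchoose, ih]
    push_cast
    linear_combination -(2 * n + 3) * (-1 / 4) ^ (n + 1) * hcentral

/-- The expansion of `(1 - a x) ^ r`. -/
noncomputable def oneSubMulXPow (a r : K) : K⟦X⟧ :=
  rescale (-a) (binomialSeries K r)

theorem coeff_oneSubMulXPow (a r : K) (n : ℕ) :
    coeff n (oneSubMulXPow a r) = (-a) ^ n * Ring.choose r n := by
  simp [oneSubMulXPow, coeff_rescale]

theorem coeff_oneSubMulXPow_neg_half (a : K) (n : ℕ) :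
    coeff n (oneSubMulXPow a (-1 / 2)) = (a / 4) ^ n * n.centralBinom := by
  rw [coeff_oneSubMulXPow, choose_neg_half, ← mul_assoc, ← mul_pow]
  ring

theorem coeff_oneSubMulXPow_neg_three_halves (a : K) (n : ℕ) :
    coeff n (oneSubMulXPow a (-3 / 2)) = (a / 4) ^ n * ((2 * n + 1) * n.centralBinom) := by
  rw [coeff_oneSubMulXPow, choose_neg_three_halves, ← mul_assoc, ← mul_pow]
  ring

theorem constantCoeff_oneSubMulXPow (a r : K) : constantCoeff (oneSubMulXPow a r) = 1 := by
  simp [← coeff_zero_eq_constantCoeff_apply, coeff_oneSubMulXPow]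

theorem oneSubMulXPow_add (a r s : K) :
    oneSubMulXPow a (r + s) = oneSubMulXPow a r * oneSubMulXPow a s := by
  simp [oneSubMulXPow]

theorem oneSubMulXPow_zero (a : K) : oneSubMulXPow a 0 = 1 := by
  simp [oneSubMulXPow]

theorem oneSubMulXPow_one (a : K) : oneSubMulXPow a 1 = 1 - C a * X := by
  have h := binomialSeries_nat (R := K) (A := K) 1
  rw [Nat.cast_one] at h
  simp [oneSubMulXPow, h, rescale_X, sub_eq_add_neg]

theorem oneSubMulXPow_half_sq (a : K) : oneSubMulXPow a (1 / 2) ^ 2 = 1 - C a * X := by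
  rw [pow_two, ← oneSubMulXPow_add, add_halves, oneSubMulXPow_one]

end BinomialSeries

section GeneratingSeries

open PowerSeries GrandMotzkin

/-- The generating series of the central trinomial coefficients. -/
noncomputable def centralTrinomialSeries : ℚ⟦X⟧ :=
  .mk fun n => (trinomial n n : ℚ)

theorem derivative_centralTrinomialSeries :
    (1 - 2 * X - 3 * X ^ 2) * d⁄dX ℚ centralTrinomialSeries
      = (1 + 3 * X) * centralTrinomialSeries := by
  have hexpand : (1 - 2 * X - 3 * X ^ 2) * d⁄dX ℚ centralTrinomialSeries
      - (1 + 3 * X) * centralTrinomialSeries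
      = d⁄dX ℚ centralTrinomialSeries - centralTrinomialSeries
        - X * (C 2 * d⁄dX ℚ centralTrinomialSeries
          + C 3 * (centralTrinomialSeries + X * d⁄dX ℚ centralTrinomialSeries)) := by
    simp only [map_ofNat]
    ring
  rw [← sub_eq_zero, hexpand]
  ext n
  rcases n with - | n
  · have hderiv : coeff 0 (d⁄dX ℚ centralTrinomialSeries) = 1 := by
      simp [coeff_derivative, centralTrinomialSeries, trinomial_one_one]
    rw [map_sub, map_sub, hderiv, coeff_zero_X_mul]
    simp [centralTrinomialSeries, trinomial_zero_zero]
  · have hX : coeff (R := ℚ) n (X * d⁄dX ℚ centralTrinomialSeries) = n * trinomial n n := by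
      rcases n with - | n
      · simp
      · simp [coeff_succ_X_mul, centralTrinomialSeries, coeff_derivative, mul_comm]
    have hrec : ((n : ℚ) + 2) * trinomial (n + 2) (n + 2)
        = (2 * n + 3) * trinomial (n + 1) (n + 1) + 3 * (n + 1) * trinomial n n := by
      exact_mod_cast add_two_mul_trinomial_add_two_self n
    simp only [map_sub, map_add, map_zero, coeff_succ_X_mul, coeff_C_mul, hX]
    simp only [centralTrinomialSeries, coeff_derivative, coeff_mk]
    push_cast
    linear_combination hrec

theorem centralTrinomialSeries_sq : centralTrinomialSeries ^ 2 * (1 - 2 * X - 3 * X ^ 2) = 1 := by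
  refine derivative.ext ?_ (by simp [centralTrinomialSeries, trinomial_zero_zero])
  have h2 : d⁄dX ℚ (2 : ℚ⟦X⟧) = 0 := by rw [← map_ofNat C, derivative_C]
  have h3 : d⁄dX ℚ (3 : ℚ⟦X⟧) = 0 := by rw [← map_ofNat C, derivative_C]
  simp only [Derivation.leibniz, Derivation.leibniz_pow, map_sub, h2, h3, derivative_X,
    smul_eq_mul, Derivation.map_one_eq_zero, nsmul_eq_mul]
  push_cast
  linear_combination 2 * centralTrinomialSeries * derivative_centralTrinomialSeries

/-- The square root of `1 - 2 x - 3 x ^ 2 = (1 - 3 x) (1 + x)` with constant term `1`. -/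
noncomputable def sqrtDiscriminant : ℚ⟦X⟧ :=
  oneSubMulXPow 3 (1 / 2) * oneSubMulXPow (-1) (1 / 2)

theorem isFormalSqrt_sqrtDiscriminant :
    IsFormalSqrt sqrtDiscriminant (1 - 2 * X - 3 * X ^ 2) := by
  refine ⟨by simp [sqrtDiscriminant, constantCoeff_oneSubMulXPow], ?_⟩
  rw [sqrtDiscriminant, mul_pow, oneSubMulXPow_half_sq, oneSubMulXPow_half_sq, map_ofNat, map_neg,
    map_one]
  ring

theorem centralTrinomialSeries_mul_sqrtDiscriminant :
    centralTrinomialSeries * sqrtDiscriminant = 1 := by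
  have hconst : constantCoeff (centralTrinomialSeries * sqrtDiscriminant) = 1 := by
    simp [isFormalSqrt_sqrtDiscriminant.1, centralTrinomialSeries, trinomial_zero_zero]
  have hsq : (centralTrinomialSeries * sqrtDiscriminant) ^ 2 = 1 := by
    rw [mul_pow, isFormalSqrt_sqrtDiscriminant.2, centralTrinomialSeries_sq]
  refine (sq_eq_one_iff.1 hsq).resolve_right fun h => ?_
  norm_num [h] at hconst

theorem centralTrinomialSeries_eq :
    centralTrinomialSeries = oneSubMulXPow 3 (-1 / 2) * oneSubMulXPow (-1) (-1 / 2) := by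
  have hinv : ∀ a : ℚ, oneSubMulXPow a (1 / 2) * oneSubMulXPow a (-1 / 2) = 1 := fun a => by
    rw [← oneSubMulXPow_add, ← oneSubMulXPow_zero a]
    norm_num
  have h := centralTrinomialSeries_mul_sqrtDiscriminant
  rw [sqrtDiscriminant] at h
  linear_combination oneSubMulXPow 3 (-1 / 2) * oneSubMulXPow (-1) (-1 / 2) * h
    - centralTrinomialSeries * oneSubMulXPow (-1) (1 / 2) * oneSubMulXPow (-1) (-1 / 2) * hinv 3
    - centralTrinomialSeries * hinv (-1)

theorem edgeSeries_mul_one_sub :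
    edgeSeries GrandMotzkin * (1 - 3 * X) = 2 * X ^ 2 * centralTrinomialSeries := by
  have hleft : edgeSeries GrandMotzkin * (1 - 3 * X)
      = edgeSeries GrandMotzkin - C 3 * (X * edgeSeries GrandMotzkin) := by
    rw [map_ofNat]
    ring
  have hright : 2 * X ^ 2 * centralTrinomialSeries
      = C 2 * (X * (X * centralTrinomialSeries)) := by
    rw [map_ofNat]
    ring
  rw [hleft, hright]
  ext n
  rcases n with - | - | - | n <;>
    simp only [map_sub, coeff_C_mul, coeff_zero_X_mul, coeff_succ_X_mul, edgeSeries,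
      centralTrinomialSeries, coeff_mk, zero_add]
  · simp [hasseEdges_of_le_one]
  · simp [hasseEdges_of_le_one]
  · simp [hasseEdges_of_le_one, hasseEdges_two, trinomial_zero_zero]
  · rw [hasseEdges_add_three n]
    push_cast
    ring

theorem edgeSeries_eq :
    edgeSeries GrandMotzkin = 2 * X ^ 2 * ((1 - 3 * X) * sqrtDiscriminant)⁻¹ := by
  rw [PowerSeries.eq_mul_inv_iff_mul_eq (by simp [isFormalSqrt_sqrtDiscriminant.1])]
  linear_combination sqrtDiscriminant * edgeSeries_mul_one_sub
    + 2 * X ^ 2 * centralTrinomialSeries_mul_sqrtDiscriminant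

theorem edgeSeries_eq_mul_oneSubMulXPow :
    edgeSeries GrandMotzkin
      = 2 * X ^ 2 * (oneSubMulXPow 3 (-3 / 2) * oneSubMulXPow (-1) (-1 / 2)) := by
  have hinv : (1 - 3 * X) * oneSubMulXPow (3 : ℚ) (-3 / 2) = oneSubMulXPow 3 (-1 / 2) := by
    have h := oneSubMulXPow_one (3 : ℚ)
    rw [map_ofNat] at h
    rw [← h, ← oneSubMulXPow_add]
    norm_num
  have hne : (1 - 3 * X : ℚ⟦X⟧) ≠ 0 := fun h => by
    simpa using congrArg constantCoeff h
  refine mul_right_cancel₀ hne ?_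
  rw [edgeSeries_mul_one_sub, centralTrinomialSeries_eq, ← hinv]
  ring

theorem hasseEdges_eq_sum_centralBinom (n : ℕ) :
    (hasseEdges (GrandMotzkin (n + 2)) : ℚ)
      = 2 / 4 ^ n * ∑ k ∈ Finset.range (n + 1),
          (k.centralBinom : ℚ) * (n - k).centralBinom * (2 * k + 1) * 3 ^ k * (-1) ^ (n - k) := by
  have hcoeff := congrArg (coeff (n + 2)) edgeSeries_eq_mul_oneSubMulXPow
  rw [edgeSeries, coeff_mk, mul_comm 2, mul_assoc, coeff_X_pow_mul, ← map_ofNat C, coeff_C_mul,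
    coeff_mul, Finset.Nat.sum_antidiagonal_eq_sum_range_succ_mk] at hcoeff
  rw [hcoeff, Finset.mul_sum, Finset.mul_sum]
  refine Finset.sum_congr rfl fun k hk => ?_
  have hpow : (4 : ℚ) ^ n = 4 ^ k * 4 ^ (n - k) := by
    rw [← pow_add, Nat.add_sub_cancel' (Finset.mem_range_succ_iff.1 hk)]
  rw [coeff_oneSubMulXPow_neg_three_halves, coeff_oneSubMulXPow_neg_half, hpow, div_pow, div_pow]
  field_simp

end GeneratingSeries

section Asymptotics


theorem tendsto_smul_sum_range_mul {R : Type*} [NormedRing R] [NormedAlgebra ℝ R]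
    [CompleteSpace R] {w : ℕ → ℝ} {a b : ℕ → R} {L : R} (hpos : ∀ n, 0 < w n)
    (hmul : ∀ i j, w (i + j) ≤ w i * w j)
    (hratio : ∀ j, Tendsto (fun n => w (n + j) / w n) atTop (𝓝 1))
    (ha : Tendsto (fun n => w n • a n) atTop (𝓝 L)) (hb : Summable fun j => w j * ‖b j‖) :
    Tendsto (fun n => w n • ∑ j ∈ Finset.range (n + 1), a (n - j) * b j) atTop
      (𝓝 (∑' j, L * b j)) := by
  obtain ⟨M, hM⟩ := ha.norm.bddAbove_range
  let f (n j : ℕ) : R := if j ≤ n then w n • (a (n - j) * b j) else 0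
  have hsum (n : ℕ) : w n • ∑ j ∈ Finset.range (n + 1), a (n - j) * b j = ∑' j, f n j := by
    rw [tsum_eq_sum fun j hj => if_neg fun h => hj (Finset.mem_range_succ_iff.2 h),
      Finset.smul_sum]
    exact Finset.sum_congr rfl fun j hj => (if_pos (Finset.mem_range_succ_iff.1 hj)).symm
  have hterm (j : ℕ) : Tendsto (f · j) atTop (𝓝 (L * b j)) := by
    rw [← tendsto_add_atTop_iff_nat j]
    have h := ((hratio j).smul ha).mul_const (b j)
    rw [one_smul] at h
    refine h.congr fun n => ?_
    rw [smul_smul, div_mul_cancel₀ _ (hpos n).ne', smul_mul_assoc]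
    simp only [f, if_pos (Nat.le_add_left j n), Nat.add_sub_cancel]
  have hbound (n j : ℕ) : ‖f n j‖ ≤ M * (w j * ‖b j‖) := by
    have hM' (m : ℕ) : w m * ‖a m‖ ≤ M := by
      simpa [norm_smul, abs_of_pos (hpos m)] using hM ⟨m, rfl⟩
    have hw := hpos j
    have hM₀ : 0 ≤ M := (mul_nonneg (hpos 0).le (norm_nonneg _)).trans (hM' 0)
    by_cases hj : j ≤ n
    · calc ‖f n j‖ = w (n - j + j) * ‖a (n - j) * b j‖ := by
            simp only [f, if_pos hj, norm_smul, Real.norm_of_nonneg (hpos n).le,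
              Nat.sub_add_cancel hj]
        _ ≤ w (n - j) * w j * (‖a (n - j)‖ * ‖b j‖) :=
            mul_le_mul (hmul _ _) (norm_mul_le _ _) (norm_nonneg _)
              (mul_pos (hpos _) (hpos _)).le
        _ = w (n - j) * ‖a (n - j)‖ * (w j * ‖b j‖) := by ring
        _ ≤ M * (w j * ‖b j‖) := by gcongr; exact hM' _
    · simp only [f, if_neg hj, norm_zero]
      positivity
  simp only [hsum]
  exact tendsto_tsum_of_dominated_convergence (hb.mul_left M) hterm
    (Eventually.of_forall fun n => hbound n)

theorem isEquivalent_centralBinom :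
    (fun n : ℕ => (n.centralBinom : ℝ)) ~[atTop] fun n => 4 ^ n / √(Real.pi * n) := by
  have hfactorial := Stirling.factorial_isEquivalent_stirling
  have hdouble := hfactorial.comp_tendsto (tendsto_id.const_mul_atTop' (two_pos : (0 : ℕ) < 2))
  refine ((hdouble.div (hfactorial.pow 2)).congr_left ?_).congr_right ?_
  · refine Eventually.of_forall fun n => ?_
    simp only [Pi.div_apply, Pi.pow_apply, Function.comp_apply, id]
    rw [Nat.centralBinom_eq_two_mul_choose, Nat.cast_choose ℝ (Nat.le_mul_of_pos_left n two_pos),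
      pow_two]
    simp only [two_mul, Nat.add_sub_cancel]
  · filter_upwards [eventually_ne_atTop 0] with n hn
    have hsqrt : √(2 * (2 * n) * Real.pi) = 2 * √(Real.pi * n) := by
      rw [← Real.sqrt_sq (zero_le_two (α := ℝ)), ← Real.sqrt_mul (by positivity),
        Real.sqrt_sq zero_le_two]
      ring_nf
    have hpow : (2 * n / Real.exp 1) ^ (2 * n) = 4 ^ n * ((n / Real.exp 1) ^ n) ^ 2 := by
      rw [mul_div_assoc, mul_pow, pow_mul, ← pow_mul (_ / _), mul_comm 2 n]
      norm_num
    have hsq : √(Real.pi * n) ^ 2 = Real.pi * n := Real.sq_sqrt (by positivity)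
    have hsq' : √(2 * n * Real.pi) ^ 2 = 2 * (Real.pi * n) := by
      rw [Real.sq_sqrt (by positivity)]
      ring
    simp only [Pi.div_apply, Pi.pow_apply, Function.comp_apply, id]
    push_cast
    rw [hsqrt, hpow, mul_pow, hsq', div_eq_div_iff (by positivity) (by positivity)]
    linear_combination 2 * 4 ^ n * ((n / Real.exp 1) ^ n) ^ 2 * hsq

theorem hasSum_centralBinom_mul_pow {x : ℝ} (hx : |x| < 1 / 4) :
    HasSum (fun n => (n.centralBinom : ℝ) * x ^ n) (1 / √(1 - 4 * x)) := by
  have hball : -(4 * x) ∈ Metric.eball 0 1 := by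
    rw [Metric.mem_eball, edist_zero_right, Real.enorm_eq_ofReal_abs, ENNReal.ofReal_lt_one,
      abs_neg, abs_mul, abs_of_pos four_pos]
    linarith
  have hrpow : (1 + -(4 * x)) ^ (-1 / 2 : ℝ) = 1 / √(1 - 4 * x) := by
    rw [neg_div, Real.rpow_neg (by linarith [(abs_lt.1 hx).2]), ← Real.sqrt_eq_rpow,
      ← sub_eq_add_neg, one_div]
  have hterm (n : ℕ) : binomialSeries ℝ (-1 / 2 : ℝ) n (fun _ => -(4 * x))
      = n.centralBinom * x ^ n := by
    rw [binomialSeries_apply, List.ofFn_const, List.prod_replicate, smul_eq_mul, choose_neg_half,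
      mul_right_comm, ← mul_pow, mul_comm]
    ring_nf
  have h := (Real.one_add_rpow_hasFPowerSeriesOnBall_zero (a := -1 / 2)).hasSum hball
  simpa only [hterm, zero_add, hrpow] using h

theorem isEquivalent_sqrt_natCast_add_one :
    (fun n : ℕ => √((n : ℝ) + 1)) ~[atTop] fun n => √n := by
  have h : (fun n : ℕ => (n : ℝ) + 1) ~[atTop] fun n => (n : ℝ) :=
    IsEquivalent.refl.add_const_of_norm_tendsto_atTop
      (tendsto_norm_atTop_atTop.comp tendsto_natCast_atTop_atTop)
  simp only [Real.sqrt_eq_rpow]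
  exact h.rpow (fun n => Nat.cast_nonneg n)

theorem tendsto_sqrt_add_div_sqrt (j : ℕ) :
    Tendsto (fun n : ℕ => √((n + j : ℕ) + 1) / √(n + 1)) atTop (𝓝 1) := by
  have h := (((tendsto_natCast_div_add_atTop (j : ℝ)).inv₀ one_ne_zero).comp
    (tendsto_add_atTop_nat 1)).sqrt
  rw [inv_one, Real.sqrt_one] at h
  refine h.congr fun n => ?_
  rw [Function.comp_apply, inv_div, Real.sqrt_div (by positivity)]
  push_cast
  ring_nf

theorem tendsto_sqrt_mul_centralBinom_div :
    Tendsto (fun n : ℕ => √(n + 1) * (n.centralBinom / 4 ^ n)) atTop (𝓝 (1 / √Real.pi)) := by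
  have hne : 1 / √Real.pi ≠ 0 := by positivity
  rw [← isEquivalent_const_iff_tendsto hne]
  refine (isEquivalent_sqrt_natCast_add_one.mul
    (isEquivalent_centralBinom.div IsEquivalent.refl)).congr_right ?_
  filter_upwards [eventually_ne_atTop 0] with n hn
  simp only [Pi.mul_apply, Pi.div_apply, Function.const_apply]
  rw [Real.sqrt_mul Real.pi_pos.le]
  field_simp

theorem trinomial_div_eq_sum_centralBinom (n : ℕ) :
    (trinomial n n : ℝ) / 3 ^ n
      = ∑ j ∈ Finset.range (n + 1),
          ((n - j).centralBinom : ℝ) / 4 ^ (n - j) * (j.centralBinom * (-1 / 12) ^ j) := by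
  have hcoeff := congrArg (PowerSeries.coeff n) centralTrinomialSeries_eq
  rw [centralTrinomialSeries, PowerSeries.coeff_mk, mul_comm, PowerSeries.coeff_mul,
    Finset.Nat.sum_antidiagonal_eq_sum_range_succ_mk] at hcoeff
  rw [← Rat.cast_natCast, hcoeff, Rat.cast_sum, Finset.sum_div]
  refine Finset.sum_congr rfl fun j hj => ?_
  have hpow : (3 : ℝ) ^ n = 3 ^ j * 3 ^ (n - j) := by
    rw [← pow_add, Nat.add_sub_cancel' (Finset.mem_range_succ_iff.1 hj)]
  rw [coeff_oneSubMulXPow_neg_half, coeff_oneSubMulXPow_neg_half, hpow,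
    show (-1 / 12 : ℝ) = -1 / 4 / 3 by norm_num]
  push_cast
  simp only [div_pow]
  field_simp

theorem summable_sqrt_mul_norm_centralBinom_mul_pow {x : ℝ} (hx : |x| < 1 / 4) :
    Summable fun j : ℕ => √(j + 1) * ‖(j.centralBinom : ℝ) * x ^ j‖ := by
  have hx' : ‖4 * |x|‖ < 1 := by
    rw [norm_mul, norm_abs_eq_norm, Real.norm_ofNat, Real.norm_eq_abs]
    linarith
  have hgeom : Summable fun j : ℕ => ((j : ℝ) + 1) * (4 * |x|) ^ j := by
    simpa [add_mul] using (summable_pow_mul_geometric_of_norm_lt_one 1 hx').add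
      (summable_geometric_of_norm_lt_one hx')
  refine hgeom.of_nonneg_of_le (fun j => by positivity) fun j => ?_
  have hsqrt : √((j : ℝ) + 1) ≤ j + 1 :=
    Real.sqrt_le_iff.2 ⟨by positivity, by nlinarith [j.cast_nonneg (α := ℝ)]⟩
  have hcentral : (j.centralBinom : ℝ) ≤ 4 ^ j := by
    exact_mod_cast j.centralBinom_le_four_pow
  rw [norm_mul, norm_pow, Real.norm_natCast, Real.norm_eq_abs, mul_pow]
  gcongr

theorem tendsto_sqrt_mul_trinomial_div :
    Tendsto (fun n : ℕ => √(n + 1) * (trinomial n n / 3 ^ n)) atTop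
      (𝓝 (√3 / (2 * √Real.pi))) := by
  have hmul (i j : ℕ) : √((i + j : ℕ) + 1) ≤ √(i + 1) * √(j + 1) := by
    rw [← Real.sqrt_mul (by positivity)]
    refine Real.sqrt_le_sqrt ?_
    push_cast
    nlinarith [mul_nonneg (Nat.cast_nonneg (α := ℝ) i) (Nat.cast_nonneg (α := ℝ) j)]
  have hx : |(-1 / 12 : ℝ)| < 1 / 4 := by norm_num [abs_div]
  have hseries : ∑' j : ℕ, 1 / √Real.pi * (j.centralBinom * (-1 / 12) ^ j)
      = √3 / (2 * √Real.pi) := by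
    have h := hasSum_centralBinom_mul_pow hx
    have hsqrt : √(1 - 4 * (-1 / 12) : ℝ) = 2 / √3 := by
      rw [show (1 - 4 * (-1 / 12) : ℝ) = 2 ^ 2 / 3 by norm_num, Real.sqrt_div (by norm_num),
        Real.sqrt_sq zero_le_two]
    rw [(h.mul_left _).tsum_eq, hsqrt]
    field_simp
  simp only [trinomial_div_eq_sum_centralBinom]
  rw [← hseries]
  exact tendsto_smul_sum_range_mul (w := fun n => √(n + 1))
    (a := fun n => (n.centralBinom : ℝ) / 4 ^ n)
    (b := fun j => (j.centralBinom : ℝ) * (-1 / 12) ^ j) (fun n => by positivity) hmul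
    tendsto_sqrt_add_div_sqrt tendsto_sqrt_mul_centralBinom_div
    (summable_sqrt_mul_norm_centralBinom_mul_pow hx)

theorem isEquivalent_trinomial :
    (fun n : ℕ => (trinomial n n : ℝ)) ~[atTop] fun n => 3 ^ n * (√3 / (2 * √(Real.pi * n))) := by
  have h := (isEquivalent_const_iff_tendsto (by positivity)).2 tendsto_sqrt_mul_trinomial_div
  have hfactor := (IsEquivalent.refl (u := fun n : ℕ => (3 : ℝ) ^ n)).div
    isEquivalent_sqrt_natCast_add_one
  refine ((hfactor.mul h).congr_left ?_).congr_right ?_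
  · refine Eventually.of_forall fun n => ?_
    simp only [Pi.mul_apply, Pi.div_apply]
    field_simp
  · refine Eventually.of_forall fun n => ?_
    simp only [Pi.mul_apply, Pi.div_apply, Function.const_apply]
    rw [Real.sqrt_mul Real.pi_pos.le]
    field_simp

theorem isEquivalent_hasseEdges :
    (fun n : ℕ => (hasseEdges (GrandMotzkin n) : ℝ)) ~[atTop]
      fun n => 2 * (3 : ℝ) ^ ((n : ℤ) - 2) * √(3 * n / Real.pi) := by
  refine isEquivalent_of_tendsto_one ?_
  rw [← tendsto_add_atTop_iff_nat 2]
  have hratio := (tendsto_sqrt_add_div_sqrt 1).inv₀ one_ne_zero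
  have htrinomial := tendsto_sqrt_mul_trinomial_div
  have hlim := ((hratio.mul htrinomial).add
    (((hratio.pow 2).mul (htrinomial.comp (tendsto_add_atTop_nat 1))).const_mul 3)).mul_const
    (√Real.pi / (2 * √3))
  have hone : (1⁻¹ * (√3 / (2 * √Real.pi)) + 3 * (1⁻¹ ^ 2 * (√3 / (2 * √Real.pi))))
      * (√Real.pi / (2 * √3)) = 1 := by
    field_simp
    norm_num
  rw [hone] at hlim
  refine hlim.congr fun n => ?_
  have hzpow : (3 : ℝ) ^ (((n + 2 : ℕ) : ℤ) - 2) = 3 ^ n := by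
    rw [Nat.cast_add, Nat.cast_ofNat, add_sub_cancel_right, zpow_natCast]
  have hsq : √((n : ℝ) + 1) ^ 2 = n + 1 := Real.sq_sqrt (by positivity)
  simp only [Pi.div_apply, Function.comp_apply, hzpow, GrandMotzkin.hasseEdges_add_two]
  rw [Real.sqrt_div (by positivity), Real.sqrt_mul zero_le_three]
  push_cast
  rw [show (n : ℝ) + 1 + 1 = n + 2 by ring, pow_succ]
  field_simp
  rw [hsq]
  ring

theorem isEquivalent_hasseIndex :
    (fun n : ℕ => hasseIndex (GrandMotzkin n)) ~[atTop] fun n => 4 / 9 * (n : ℝ) := by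
  refine ((isEquivalent_hasseEdges.div isEquivalent_trinomial).congr_left ?_).congr_right ?_
  · refine Eventually.of_forall fun n => ?_
    simp only [hasseIndex, GrandMotzkin.card_eq_trinomial, Pi.div_apply]
  · filter_upwards [eventually_ne_atTop 0] with n hn
    have hzpow : (3 : ℝ) ^ ((n : ℤ) - 2) = 3 ^ n / 9 := by
      rw [zpow_sub₀ three_ne_zero, zpow_natCast]
      norm_num
    have hsq : √(n : ℝ) ^ 2 = n := Real.sq_sqrt n.cast_nonneg
    rw [Pi.div_apply, hzpow, Real.sqrt_div (by positivity), Real.sqrt_mul zero_le_three,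
      Real.sqrt_mul Real.pi_pos.le]
    field_simp
    linear_combination 4 * hsq

theorem asymptoticallyQuasiBoolean_grandMotzkin : AsymptoticallyQuasiBoolean GrandMotzkin := by
  refine ⟨1 / 18, by norm_num, by norm_num, Or.inr ?_⟩
  norm_num only
  exact isEquivalent_hasseIndex

end Asymptotics

theorem mainTheorem4 :
    -- edge generating series
    (∃ S : PowerSeries ℚ,
      IsFormalSqrt S (1 - 2 * PowerSeries.X - 3 * PowerSeries.X ^ 2) ∧
      edgeSeries GrandMotzkin
        = 2 * PowerSeries.X ^ 2 * ((1 - 3 * PowerSeries.X) * S)⁻¹) ∧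
    -- summation formulas
    (∀ n : ℕ, hasseEdges (GrandMotzkin (n + 2))
      = 2 * ∑ k ∈ Finset.range (n + 1), trinomial k k * 3 ^ (n - k)) ∧
    (∀ n : ℕ, (hasseEdges (GrandMotzkin (n + 2)) : ℚ)
      = 2 / 4 ^ n * ∑ k ∈ Finset.range (n + 1),
          (Nat.choose (2 * k) k : ℚ) * (Nat.choose (2 * n - 2 * k) (n - k) : ℚ)
            * (2 * (k : ℚ) + 1) * 3 ^ k * (-1) ^ (n - k)) ∧
    (∀ n : ℕ, (hasseEdges (GrandMotzkin (n + 2)) : ℤ)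
      = 2 * ∑ k ∈ Finset.range (n + 1),
          (Nat.choose (n + 1) (k + 1) : ℤ) * (Nat.choose (2 * k) k : ℤ)
            * (-1) ^ k * 3 ^ (n - k)) ∧
    -- asymptotic equivalences
    ((fun n : ℕ => (hasseEdges (GrandMotzkin n) : ℝ)) ~[atTop]
      (fun n : ℕ => 2 * (3 : ℝ) ^ ((n : ℤ) - 2) * Real.sqrt (3 * (n : ℝ) / Real.pi))) ∧
    ((fun n : ℕ => hasseIndex (GrandMotzkin n)) ~[atTop]
      (fun n : ℕ => 4 / 9 * (n : ℝ))) ∧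
    AsymptoticallyQuasiBoolean GrandMotzkin := by
  refine ⟨⟨sqrtDiscriminant, isFormalSqrt_sqrtDiscriminant, edgeSeries_eq⟩,
    hasseEdges_eq_sum_trinomial, fun n => ?_, fun n => ?_, isEquivalent_hasseEdges,
    isEquivalent_hasseIndex, asymptoticallyQuasiBoolean_grandMotzkin⟩
  · simp only [← Nat.mul_sub, ← Nat.centralBinom_eq_two_mul_choose]
    exact hasseEdges_eq_sum_centralBinom n
  · simp only [← Nat.centralBinom_eq_two_mul_choose]
    exact hasseEdges_eq_sum_choose n
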